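/- Let $\Gamma$ be a finitely generated group, let $X,Y$ be compact metrizable spaces on which $\Gamma$ acts by homeomorphisms, and let $f\colon X\to Y$ be a topological factor map, i.e. a continuous surjection with $f(gx)=gf(x)$ for all $g\in\Gamma$, $x\in X$. Assume that $Y$ is zero-dimensional (its clopen sets form a basis of its topology). 1. If $\Gamma$ is recursively presented and $\Gamma\curvearrowright X$ is an effective dynamical system (EDS), then $\Gamma\curvearrowright Y$ is a weak effective dynamical system (WEDS). 2. If $\Gamma\curvearrowright X$ is a WEDS, then $\Gamma\curvearrowright Y$ is a WEDS. Here the following notions are used. * $\Gamma$ is *recursively presented* if, for a finite set $S$ such that every element of $\Gamma$ is a product of elements of $S$, the set of words $w\in S^*$ that represent $1_\Gamma$ is recursively enumerable (r.e.). * A *computable metric space* is a metric space $(M,d)$ with a dense sequence $(s_i)_{i\in\mathbb N}$ such that the distances $d(s_i,s_j)$ are computable uniformly in $i,j$. Its *basic balls* are the open balls $B(s_i,r)$ with $r\in\mathbb Q_{>0}$, enumerated in the obvious way as $(B_n)_{n\in\mathbb N}$. A compact set $K\subset M$ is *recursively compact* if the set of finite sets $I\subset\mathbb N$ with $K\subset\bigcup_{n\in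 I}B_n$ is r.e. A map $h\colon K\to M'$ into a computable metric space with basic balls $(B'_m)$ is *computable* if there are sets $I_m\subset\mathbb N$, r.e. uniformly in $m$, with $h^{-1}(B'_m)=K\cap\bigcup_{n\in I_m}B_n$ for all $m$. An action $\Gamma\curvearrowright K$ is *computable* if the elements of some finite generating set of $\Gamma$ act by computable maps. * $\Gamma\curvearrowright X$ is an *EDS* if it is topologically conjugate to a computable action of $\Gamma$ on a recursively compact subset of a computable metric space. (The conjugacy need not be computable.) * A *subshift* $Z\subset A^\Gamma$ ($A$ finite) is a subset that is closed in the prodiscrete topology and invariant under the shift $(gz)(h)=z(g^{-1}h)$. It is *effective* if for some finite symmetric generating set $S$ of $\Gamma$, with canonical epimorphism $\phi\colon F(S)\to\Gamma$ from the free group on $S$, the pullback $\widehat Z=\{z\circ\phi : z\in Z\}\subset A^{F(S)}$ is effectively closed, i.e. $A^{F(S)}\setminus\widehat Z$ is the union of the cylinders of an r.e. set of finite patterns on $F(S)$. * An action $\Gamma\curvearrowright X$ on a zero-dimensional compact metrizable space is a *WEDS* if for every $n$ and every partition $\mathcal P=(P_i)_{i=1}^n$ of $X$ into clopen sets the subshift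 $$Y(\Gamma\curvearrowright X,\mathcal P)=\{y\in\{1,\dots,n\}^\Gamma : \text{there is } x\in X \text{ with } g^{-1}x\in P_{y(g)} \text{ for every } g\in\Gamma\}$$ is effective. -/

import Mathlib

open Set Topology TopologicalSpace

/-- The list `s 0, …, s (k-1)` generates `Γ`: every element is a product of a word in the `s i`. -/
def GeneratesGroup {Γ : Type*} [Group Γ] {k : ℕ} (s : Fin k → Γ) : Prop :=
  ∀ g : Γ, ∃ w : List (Fin k), (w.map s).prod = g

/-- A (finitely generated) group is recursively presented if, for a finite generating set, the set
of words that represent the identity is recursively enumerable. -/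
def IsRecursivelyPresented (Γ : Type*) [Group Γ] : Prop :=
  ∃ (k : ℕ) (s : Fin k → Γ), GeneratesGroup s ∧
    REPred (fun w : List (Fin k) => (w.map s).prod = 1)

/-! ### Computable metric spaces -/

/-- The rational number `(a - b) / (c + 1)` named by a triple of natural numbers. -/
def namedRat (q : ℕ × ℕ × ℕ) : ℚ := ((q.1 : ℚ) - (q.2.1 : ℚ)) / ((q.2.2 : ℚ) + 1)

/-- A computable metric space structure on `M`: a dense sequence of points whose mutual distances
are uniformly computable. -/
structure ComputableMetricStructure (M : Type*) [MetricSpace M] where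
  /-- the dense sequence -/
  pt : ℕ → M
  dense_pt : DenseRange pt
  computable_dist : ∃ q : ℕ × ℕ × ℕ → ℕ × ℕ × ℕ, Computable q ∧
    ∀ i j n : ℕ, |dist (pt i) (pt j) - (namedRat (q (i, j, n)) : ℝ)| ≤ (1 / 2 : ℝ) ^ n

/-- Names of basic balls: `(i, a, b)` names the ball with centre `pt i` and radius
`(a + 1) / (b + 1)`; every positive rational radius occurs. -/
abbrev BallName : Type := ℕ × ℕ × ℕ

namespace ComputableMetricStructure

variable {M : Type*} [MetricSpace M] (C : ComputableMetricStructure M)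

/-- The basic (open) ball with a given name. -/
def basicBall (b : BallName) : Set M :=
  Metric.ball (C.pt b.1) (((b.2.1 : ℝ) + 1) / ((b.2.2 : ℝ) + 1))

/-- A compact set `K` is recursively compact if it is semi-decidable whether a finite list of basic
balls covers it. -/
def IsRecursivelyCompact (K : Set M) : Prop :=
  IsCompact K ∧ REPred (fun I : List BallName => K ⊆ ⋃ b ∈ I, C.basicBall b)

/-- A function `f : K → M'` on a subset `K` of `M` is computable if, uniformly in `m`, the
preimage of the basic ball `m` of `M'` is the trace on `K` of a recursively enumerable union of basic
balls of `M`. -/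
def IsComputableMap {M' : Type*} [MetricSpace M'] (C' : ComputableMetricStructure M')
    {K : Set M} (f : K → M') : Prop :=
  ∃ R : BallName × BallName → Prop, REPred R ∧
    ∀ m : BallName, f ⁻¹' C'.basicBall m = {x : K | ∃ j, R (m, j) ∧ (x : M) ∈ C.basicBall j}

/-- An action of `Γ` on a subset `K` of `M` is computable if for some finite generating set of `Γ`
each generator acts by a computable map. -/
def IsComputableAction (Γ : Type*) [Group Γ] (K : Set M) [MulAction Γ K] : Prop :=
  ∃ (k : ℕ) (s : Fin k → Γ), GeneratesGroup s ∧
    ∀ i, C.IsComputableMap C (fun x : K => ((s i • x : K) : M))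

end ComputableMetricStructure

/-! ### Dynamical systems -/

universe uΓ uX uY uM

/-- An action of `Γ` on `X` is an effective dynamical system (EDS) if it is topologically conjugate
to a computable action on a recursively compact subset of a computable metric space. -/
def IsEDS (Γ : Type uΓ) [Group Γ] (X : Type uX) [TopologicalSpace X] [MulAction Γ X] : Prop :=
  ∃ (M : Type uM) (_ : MetricSpace M) (C : ComputableMetricStructure M) (K : Set M)
    (_ : MulAction Γ K), C.IsRecursivelyCompact K ∧ C.IsComputableAction Γ K ∧
      ∃ e : X ≃ₜ K, ∀ (g : Γ) (x : X), e (g • x) = g • e x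

/-- Topological factor maps. -/
structure IsTopologicalFactorMap (Γ : Type*) [Group Γ] {X Y : Type*} [TopologicalSpace X]
    [MulAction Γ X] [TopologicalSpace Y] [MulAction Γ Y] (f : X → Y) : Prop where
  continuous : Continuous f
  surjective : Function.Surjective f
  map_smul : ∀ (g : Γ) (x : X), f (g • x) = g • f x

/-- A (compact metrizable) space has topological dimension zero if its clopen sets form a basis. -/
def IsZeroDimensional (X : Type*) [TopologicalSpace X] : Prop :=
  IsTopologicalBasis {U : Set X | IsClopen U}

/-! ### Effective subshifts -/

/-- A `Γ`-subshift: a closed set of configurations (for the prodiscrete topology) that is invariant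
under the shift `(g x)(h) = x (g⁻¹ h)`. -/
def IsSubshift {Γ : Type*} [Group Γ] {n : ℕ} (X : Set (Γ → Fin n)) : Prop :=
  IsClosed X ∧ ∀ (g : Γ), ∀ x ∈ X, (fun h => x (g⁻¹ * h)) ∈ X

/-- A name of a pattern with finite support over the free group on `k` letters: a list of pairs of a
group word (a word in the letters and their formal inverses) and a symbol. -/
abbrev PatternName (k n : ℕ) : Type := List (List (Fin k × Bool) × Fin n)

/-- The cylinder of the configurations on the free group that agree with the pattern named `p`. -/
def patternCylinder {k n : ℕ} (p : PatternName k n) : Set (FreeGroup (Fin k) → Fin n) :=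
  {x | ∀ c ∈ p, x (FreeGroup.mk c.1) = c.2}

/-- A set of configurations on the free group is effectively closed if its complement is the union
of the cylinders of a recursively enumerable set of patterns. -/
def IsEffectivelyClosed {k n : ℕ} (X : Set (FreeGroup (Fin k) → Fin n)) : Prop :=
  ∃ L : PatternName k n → Prop, REPred L ∧ Xᶜ = {x | ∃ p, L p ∧ x ∈ patternCylinder p}

/-- The pullback of a set of configurations on `Γ` to the free group on the generators `s`. -/
def pullbackConfigs {Γ : Type*} [Group Γ] {k n : ℕ} (s : Fin k → Γ) (X : Set (Γ → Fin n)) :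
    Set (FreeGroup (Fin k) → Fin n) :=
  (fun (x : Γ → Fin n) (w : FreeGroup (Fin k)) => x (FreeGroup.lift s w)) '' X

/-- A `Γ`-subshift is effective if for some finite symmetric generating set (enumerated without
repetition by `s`) its pullback to the free group on that set is effectively closed. -/
def IsEffectiveSubshift {Γ : Type*} [Group Γ] {n : ℕ} (X : Set (Γ → Fin n)) : Prop :=
  IsSubshift X ∧ ∃ (k : ℕ) (s : Fin k → Γ), Function.Injective s ∧ GeneratesGroup s ∧
    (∀ i, (s i)⁻¹ ∈ range s) ∧ IsEffectivelyClosed (pullbackConfigs s X)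

/-! ### Weak effective dynamical systems -/

/-- `P` is a partition of `X` into `n` labelled clopen sets (parts may be empty; such parts only add
unused symbols to the alphabet of the associated subshift). -/
structure IsClopenPartition {X : Type*} [TopologicalSpace X] {n : ℕ} (P : Fin n → Set X) :
    Prop where
  isClopen : ∀ i, IsClopen (P i)
  disjoint : Pairwise (fun i j => Disjoint (P i) (P j))
  cover : ⋃ i, P i = univ

/-- The subshift of the itineraries of the points of `X` through the partition `P`. -/
def partitionSubshift (Γ : Type*) [Group Γ] {X : Type*} [MulAction Γ X] {n : ℕ}
    (P : Fin n → Set X) : Set (Γ → Fin n) :=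
  {y | ∃ x : X, ∀ g : Γ, g⁻¹ • x ∈ P (y g)}

/-- An action on a zero-dimensional space is a weak effective dynamical system (WEDS) if the
subshifts associated to its clopen partitions are all effective. -/
def IsWEDS (Γ : Type*) [Group Γ] (X : Type*) [TopologicalSpace X] [MulAction Γ X] : Prop :=
  IsZeroDimensional X ∧ ∀ (n : ℕ) (P : Fin n → Set X), IsClopenPartition P →
    IsEffectiveSubshift (partitionSubshift Γ P)

/-! By equivariance and surjectivity of `f`, a clopen partition of `Y` and its pullback to `X` have
the same itinerary subshift (`IsTopologicalFactorMap.partitionSubshift_preimage`). This settles the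
second claim and reduces the first to clopen partitions of an EDS.

For those, forbid every finite pattern that no point follows. Compactness shows that these patterns
exclude exactly the configurations outside the pullback (`isEffectivelyClosed_pullbackConfigs`).
Patterns giving two labels to one group element are among them, because the parts are disjoint.

It remains to enumerate the patterns, that is, to semi-decide whether finitely many translates of
complements of parts cover the space. In the computable model such a complement is a finite union of
basic balls, and pulling a ball back along a word gives an r.e. union of balls. Recursive
compactness then confirms a cover (`rePred_preimages_cover`). -/

/-! ### Closure properties of recursively enumerable predicates -/

namespace REPred

variable {α β : Type*} [Primcodable α] [Primcodable β]

theorem of_exists_primrecRel {q : α → ℕ → Prop} (hq : PrimrecRel q) :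
    REPred fun a => ∃ n, q a n := by
  classical
  have hd : Primrec₂ fun a n => decide (q a n) := hq.decide
  have h : Partrec fun a => Nat.rfind fun n => Part.some (decide (q a n)) :=
    Partrec.rfind hd.to_comp.partrec₂
  refine h.dom_re.of_eq fun a => ?_
  refine Nat.rfind_dom.trans ?_
  simp

/-- Kleene's normal form for recursively enumerable predicates. -/
theorem exists_primrecRel {p : α → Prop} (hp : REPred p) :
    ∃ q : α → ℕ → Prop, PrimrecRel q ∧ ∀ a, p a ↔ ∃ n, q a n := by
  obtain ⟨c, hc⟩ := Nat.Partrec.Code.exists_code.1 hp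
  refine ⟨fun a n => (Nat.Partrec.Code.evaln n c (Encodable.encode a)).isSome = true, ?_, ?_⟩
  · have h : Primrec fun x : α × ℕ =>
        (Nat.Partrec.Code.evaln x.2 c (Encodable.encode x.1)).isSome :=
      Primrec.option_isSome.comp (Nat.Partrec.Code.primrec_evaln.comp
        ((Primrec.snd.pair (Primrec.const c)).pair (Primrec.encode.comp Primrec.fst)))
    exact Primrec.primrecPred (by simpa using h)
  · intro a
    have h1 : p a ↔ ∃ x, x ∈ Nat.Partrec.Code.eval c (Encodable.encode a) := by
      rw [hc]
      simp [Encodable.encodek]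
    rw [h1]
    simp only [Nat.Partrec.Code.evaln_complete, Option.isSome_iff_exists, Option.mem_def]
    exact exists_comm

/-- The witness in the normal form may be taken to be a bound. -/
theorem exists_primrecRel_monotone {p : α → Prop} (hp : REPred p) :
    ∃ q : α → ℕ → Prop, PrimrecRel q ∧ (∀ a, p a ↔ ∃ n, q a n) ∧
      ∀ a m n, m ≤ n → q a m → q a n := by
  obtain ⟨q, hq, hpq⟩ := hp.exists_primrecRel
  refine ⟨fun a n => ∃ m < n, q a m, ?_, fun a => ?_, ?_⟩
  · have h : PrimrecRel fun (m : ℕ) (a : α) => q a m := hq.comp Primrec.snd Primrec.fst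
    exact PrimrecPred.of_eq
      (h.exists_mem_list.comp (Primrec.list_range.comp Primrec.snd) Primrec.fst)
      fun x => by simp
  · rw [hpq]
    exact ⟨fun ⟨n, hn⟩ => ⟨n + 1, n, Nat.lt_succ_self n, hn⟩, fun ⟨_, m, _, hm⟩ => ⟨m, hm⟩⟩
  · rintro a m n hmn ⟨l, hl, hq⟩
    exact ⟨l, hl.trans_le hmn, hq⟩

theorem of_primrecPred {p : α → Prop} (hp : PrimrecPred p) : REPred p :=
  hp.computablePred.to_re

theorem comp {p : β → Prop} (hp : REPred p) {f : α → β} (hf : Primrec f) :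
    REPred fun a => p (f a) :=
  Partrec.comp hp hf.to_comp

theorem and {p q : α → Prop} (hp : REPred p) (hq : REPred q) : REPred fun a => p a ∧ q a := by
  obtain ⟨r, hr, hpr, hr'⟩ := hp.exists_primrecRel_monotone
  obtain ⟨s, hs, hqs, hs'⟩ := hq.exists_primrecRel_monotone
  have h : PrimrecRel fun a n => r a n ∧ s a n := PrimrecPred.and hr hs
  refine (of_exists_primrecRel h).of_eq fun a => ?_
  rw [hpr, hqs]
  constructor
  · rintro ⟨n, h1, h2⟩
    exact ⟨⟨n, h1⟩, ⟨n, h2⟩⟩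
  · rintro ⟨⟨m, h1⟩, ⟨n, h2⟩⟩
    exact ⟨max m n, hr' _ _ _ (le_max_left _ _) h1, hs' _ _ _ (le_max_right _ _) h2⟩

theorem exists_snd {p : α → β → Prop} (hp : REPred fun x : α × β => p x.1 x.2) :
    REPred fun a => ∃ b, p a b := by
  classical
  obtain ⟨q, hq, hpq⟩ := hp.exists_primrecRel
  have hd : Primrec₂ fun x n => decide (q x n) := hq.decide
  -- One number codes both the witness and its stage of confirmation; a number that decodes to
  -- nothing counts as failure through the default `false`.
  have h : Primrec fun x : α × ℕ => ((Encodable.decode (α := β × ℕ) x.2).map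
      fun y => decide (q (x.1, y.1) y.2)).getD false :=
    Primrec.option_getD.comp
      (Primrec.option_map (Primrec.decode.comp Primrec.snd)
        (hd.comp ((Primrec.fst.comp Primrec.fst).pair (Primrec.fst.comp Primrec.snd))
          (Primrec.snd.comp Primrec.snd)))
      (Primrec.const false)
  have h' : PrimrecRel fun (a : α) (n : ℕ) => ((Encodable.decode (α := β × ℕ) n).map
      fun y => decide (q (a, y.1) y.2)).getD false = true :=
    Primrec.primrecPred (by simpa using h)
  refine (of_exists_primrecRel h').of_eq fun a => ?_
  constructor
  · rintro ⟨m, hm⟩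
    cases hy : Encodable.decode (α := β × ℕ) m with
    | none => simp [hy] at hm
    | some y =>
      refine ⟨y.1, (hpq (a, y.1)).2 ⟨y.2, ?_⟩⟩
      simpa [hy] using hm
  · rintro ⟨b, hb⟩
    obtain ⟨n, hn⟩ := (hpq (a, b)).1 hb
    exact ⟨Encodable.encode (b, n), by simpa [Encodable.encodek] using hn⟩

theorem forall_mem_list {p : α → β → Prop} (hp : REPred fun x : α × β => p x.1 x.2) :
    REPred fun x : α × List β => ∀ b ∈ x.2, p x.1 b := by
  obtain ⟨q, hq, hpq, hmono⟩ := hp.exists_primrecRel_monotone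
  have h1 : PrimrecRel fun (b : β) (y : α × ℕ) => q (y.1, b) y.2 :=
    hq.comp ((Primrec.fst.comp Primrec.snd).pair Primrec.fst) (Primrec.snd.comp Primrec.snd)
  have h2 : PrimrecRel fun (x : α × List β) (n : ℕ) => ∀ b ∈ x.2, q (x.1, b) n :=
    h1.forall_mem_list.comp (Primrec.snd.comp Primrec.fst)
      ((Primrec.fst.comp Primrec.fst).pair Primrec.snd)
  refine (of_exists_primrecRel h2).of_eq fun x => ?_
  constructor
  · rintro ⟨n, hn⟩ b hb
    exact (hpq (x.1, b)).2 ⟨n, hn b hb⟩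
  · intro h
    have h3 : ∀ b : β, ∃ n, b ∈ x.2 → q (x.1, b) n := fun b => by
      by_cases hb : b ∈ x.2
      · obtain ⟨n, hn⟩ := (hpq (x.1, b)).1 (h b hb)
        exact ⟨n, fun _ => hn⟩
      · exact ⟨0, fun h => absurd h hb⟩
    choose N hN using h3
    -- The sum dominates the stage of each member of the list, so by monotonicity one stage serves
    -- them all.
    refine ⟨(x.2.map N).sum, fun b hb => hmono _ _ _ ?_ (hN b hb)⟩
    exact List.le_sum_of_mem (List.mem_map_of_mem hb)

theorem exists_mem_list {p : α → β → Prop} (hp : REPred fun x : α × β => p x.1 x.2) :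
    REPred fun x : α × List β => ∃ b ∈ x.2, p x.1 b := by
  have h : PrimrecRel fun (l : List β) (b : β) => ∃ b' ∈ l, b' = b :=
    PrimrecRel.exists_mem_list Primrec.eq
  have h1 : REPred fun y : (α × List β) × β => (∃ b' ∈ y.1.2, b' = y.2) ∧ p y.1.1 y.2 :=
    (of_primrecPred (h.comp (Primrec.snd.comp Primrec.fst) Primrec.snd)).and
      (hp.comp ((Primrec.fst.comp Primrec.fst).pair Primrec.snd))
  refine (exists_snd (p := fun (x : α × List β) b => (∃ b' ∈ x.2, b' = b) ∧ p x.1 b) h1).of_eq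
    fun x => ?_
  simp

theorem forall_mem_exists_mem_list {p : α → β → Prop} (hp : REPred fun x : α × β => p x.1 x.2) :
    REPred fun x : List α × List β => ∀ b ∈ x.2, ∃ a ∈ x.1, p a b := by
  have h1 : REPred fun x : β × List α => ∃ a ∈ x.2, p a x.1 :=
    exists_mem_list (p := fun b a => p a b) (hp.comp (Primrec.snd.pair Primrec.fst))
  exact forall_mem_list (p := fun (l : List α) b => ∃ a ∈ l, p a b)
    (h1.comp (Primrec.snd.pair Primrec.fst))

/-- No uniformity in `i` is required: finitely many normal forms, chosen arbitrarily, are combined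
by a finite case distinction. -/
theorem fin_cases {k : ℕ} {p : Fin k → α → Prop} (hp : ∀ i, REPred (p i)) :
    REPred fun x : Fin k × α => p x.1 x.2 := by
  classical
  choose q hq hpq using fun i => (hp i).exists_primrecRel
  have h1 : ∀ i, Primrec fun y : α × ℕ => decide (q i y.1 y.2) := fun i => (hq i).decide
  have h2 : Primrec fun y : (Fin k × α) × ℕ => decide (q y.1.1 y.1.2 y.2) :=
    (Primrec.fin_curry₁.2 h1).comp (Primrec.fst.comp Primrec.fst)
      ((Primrec.snd.comp Primrec.fst).pair Primrec.snd)
  have h3 : PrimrecRel fun (x : Fin k × α) (n : ℕ) => q x.1 x.2 n := Primrec.primrecPred h2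
  exact (of_exists_primrecRel h3).of_eq fun x => (hpq x.1 x.2).symm

end REPred

/-! ### Paths labelled by words -/

/-- There is a path from `b` to `b'` whose steps are taken in the relations `R i`, for `i` running
through the letters of the given word. -/
def LabelledPath {ι β : Type*} (R : ι → β → β → Prop) : List ι → β → β → Prop
  | [], b, b' => b = b'
  | i :: u, b, b' => ∃ c, R i b c ∧ LabelledPath R u c b'

/-- The end of a list of labelled steps, if each step begins where the previous one ended. -/
def followSteps {ι β : Type*} [DecidableEq β] (o : Option β) (l : List (ι × β × β)) : Option β :=
  l.foldl (fun o t => o.bind fun c => if t.2.1 = c then some t.2.2 else none) o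

section followSteps

variable {ι β : Type*} [DecidableEq β]

@[simp]
theorem followSteps_nil (o : Option β) : followSteps o ([] : List (ι × β × β)) = o := rfl

@[simp]
theorem followSteps_none (l : List (ι × β × β)) : followSteps none l = none := by
  induction l with
  | nil => rfl
  | cons t l ih => exact ih

theorem followSteps_some_cons (b : β) (t : ι × β × β) (l : List (ι × β × β)) :
    followSteps (some b) (t :: l) = if t.2.1 = b then followSteps (some t.2.2) l else none := by
  by_cases h : t.2.1 = b
  · simp [followSteps, h]
  · have h' : followSteps (some b) (t :: l) = followSteps none l := by simp [followSteps, h]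
    rw [h', followSteps_none, if_neg h]

/-- Storing the whole path in one list replaces the nested existentials by a single one, followed by
a primitive recursive check and a quantifier over the members of the list. -/
theorem labelledPath_iff_exists_followSteps {R : ι → β → β → Prop} (u : List ι) (b b' : β) :
    LabelledPath R u b b' ↔ ∃ l : List (ι × β × β),
      (l.map Prod.fst = u ∧ followSteps (some b) l = some b') ∧ ∀ t ∈ l, R t.1 t.2.1 t.2.2 := by
  induction u generalizing b with
  | nil =>
    simp only [LabelledPath, List.map_eq_nil_iff]
    constructor
    · rintro rfl
      exact ⟨[], by simp⟩
    · rintro ⟨l, ⟨rfl, h⟩, -⟩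
      simpa using h
  | cons i u ih =>
    simp only [LabelledPath, ih]
    constructor
    · rintro ⟨c, hc, l, ⟨rfl, h⟩, hl⟩
      refine ⟨(i, b, c) :: l, ⟨rfl, by simpa [followSteps_some_cons] using h⟩, ?_⟩
      simpa [hc] using hl
    · rintro ⟨_ | ⟨t, l⟩, ⟨h1, h2⟩, hl⟩
      · simp at h1
      · rw [List.map_cons, List.cons.injEq] at h1
        obtain ⟨rfl, rfl⟩ := h1
        rw [followSteps_some_cons] at h2
        split_ifs at h2 with hb
        subst hb
        exact ⟨t.2.2, hl t (by simp), l, ⟨rfl, h2⟩, fun t' ht' => hl t' (by simp [ht'])⟩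

theorem primrec_followSteps [Primcodable ι] [Primcodable β] :
    Primrec₂ (followSteps : Option β → List (ι × β × β) → Option β) := by
  have heq : PrimrecPred fun y : ((Option β × List (ι × β × β)) × Option β × ι × β × β) × β =>
      y.1.2.2.2.1 = y.2 :=
    Primrec.eq.comp (Primrec.fst.comp (Primrec.snd.comp (Primrec.snd.comp
      (Primrec.snd.comp Primrec.fst)))) Primrec.snd
  have hstep : Primrec₂ fun (y : (Option β × List (ι × β × β)) × Option β × ι × β × β) (c : β) =>
      if y.2.2.2.1 = c then some y.2.2.2.2 else none :=
    Primrec.ite heq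
      (Primrec.option_some.comp (Primrec.snd.comp (Primrec.snd.comp (Primrec.snd.comp
        (Primrec.snd.comp Primrec.fst)))))
      (Primrec.const none)
  exact Primrec.list_foldl Primrec.snd Primrec.fst
    (Primrec.option_bind (Primrec.fst.comp Primrec.snd) hstep).to₂

theorem REPred.labelledPath [Primcodable ι] [Primcodable β] {R : ι → β → β → Prop}
    (hR : REPred fun t : ι × β × β => R t.1 t.2.1 t.2.2) :
    REPred fun x : (List ι × β) × β => LabelledPath R x.1.1 x.1.2 x.2 := by
  have h1 : PrimrecPred fun y : ((List ι × β) × β) × List (ι × β × β) =>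
      y.2.map Prod.fst = y.1.1.1 :=
    Primrec.eq.comp (Primrec.list_map Primrec.snd (Primrec.fst.comp Primrec.snd))
      (Primrec.fst.comp (Primrec.fst.comp Primrec.fst))
  have h2 : PrimrecPred fun y : ((List ι × β) × β) × List (ι × β × β) =>
      followSteps (some y.1.1.2) y.2 = some y.1.2 :=
    Primrec.eq.comp
      (primrec_followSteps.comp (Primrec.option_some.comp (Primrec.snd.comp (Primrec.fst.comp
        Primrec.fst))) Primrec.snd)
      (Primrec.option_some.comp (Primrec.snd.comp Primrec.fst))
  have h3 : REPred fun y : ((List ι × β) × β) × List (ι × β × β) =>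
      ∀ t ∈ y.2, R t.1 t.2.1 t.2.2 :=
    REPred.forall_mem_list (p := fun _ (t : ι × β × β) => R t.1 t.2.1 t.2.2)
      (hR.comp Primrec.snd)
  have h4 := (REPred.of_primrecPred (h1.and h2)).and h3
  refine (REPred.exists_snd (p := fun (x : (List ι × β) × β) (l : List (ι × β × β)) =>
    (l.map Prod.fst = x.1.1 ∧ followSteps (some x.1.2) l = some x.2) ∧
      ∀ t ∈ l, R t.1 t.2.1 t.2.2) h4).of_eq fun x => ?_
  exact (labelledPath_iff_exists_followSteps x.1.1 x.1.2 x.2).symm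

end followSteps

/-! ### Computable actions on recursively compact sets -/

namespace ComputableMetricStructure

variable {M : Type*} [MetricSpace M] (C : ComputableMetricStructure M)

theorem isOpen_basicBall (b : BallName) : IsOpen (C.basicBall b) := Metric.isOpen_ball

theorem exists_basicBall_subset {x : M} {U : Set M} (hU : IsOpen U) (hx : x ∈ U) :
    ∃ b : BallName, x ∈ C.basicBall b ∧ C.basicBall b ⊆ U := by
  obtain ⟨ε, hε, hεU⟩ := Metric.isOpen_iff.1 hU x hx
  -- With a radius below `ε / 2`, a ball that contains `x` lies within `ε` of `x`.
  obtain ⟨n, hn⟩ := exists_nat_one_div_lt (half_pos hε)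
  have hpos : (0 : ℝ) < 1 / ((n : ℝ) + 1) := by positivity
  obtain ⟨i, hi⟩ := C.dense_pt.exists_dist_lt x hpos
  have hball : C.basicBall (i, 0, n) = Metric.ball (C.pt i) (1 / ((n : ℝ) + 1)) := by
    simp [basicBall]
  refine ⟨(i, 0, n), by rwa [hball, Metric.mem_ball], fun y hy => hεU ?_⟩
  rw [hball, Metric.mem_ball] at hy
  rw [Metric.mem_ball]
  have := dist_triangle_right y x (C.pt i)
  linarith

/-- A clopen subset of a compact set is the trace of a finite union of basic balls. -/
theorem exists_list_basicBall_of_isClopen {K : Set M} (hK : IsCompact K) {U : Set K}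
    (hU : IsClopen U) :
    ∃ V : List BallName, ∀ x : K, x ∈ U ↔ ∃ b ∈ V, (x : M) ∈ C.basicBall b := by
  classical
  have : CompactSpace K := isCompact_iff_compactSpace.1 hK
  -- Openness of `U` yields balls whose traces stay inside it; closedness makes `U` compact, so
  -- finitely many suffice.
  obtain ⟨O, hO, rfl⟩ := isOpen_induced_iff.1 hU.isOpen
  obtain ⟨F, hF⟩ := hU.isClosed.isCompact.elim_finite_subcover
    (fun b : {b : BallName // C.basicBall b ⊆ O} => (Subtype.val : K → M) ⁻¹' C.basicBall b)
    (fun b => (C.isOpen_basicBall b).preimage continuous_subtype_val) (by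
      intro x hx
      obtain ⟨b, hb, hbO⟩ := C.exists_basicBall_subset hO hx
      exact mem_iUnion.2 ⟨⟨b, hbO⟩, hb⟩)
  refine ⟨(F.image Subtype.val).toList, fun x => ⟨fun hx => ?_, ?_⟩⟩
  · obtain ⟨b, hbF, hb⟩ := mem_iUnion₂.1 (hF hx)
    exact ⟨b, Finset.mem_toList.2 (Finset.mem_image_of_mem _ hbF), hb⟩
  · rintro ⟨b, hb, hx⟩
    obtain ⟨b', -, rfl⟩ := Finset.mem_image.1 (Finset.mem_toList.1 hb)
    exact b'.2 hx

variable {C} {Γ : Type*} [Group Γ] {K : Set M} [MulAction Γ K]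

/-- The first letter of a word acts last, so pulling a ball back consumes the word from its head, as
`LabelledPath` does. -/
theorem prod_smul_mem_basicBall_iff {k : ℕ} {s : Fin k → Γ}
    {R : Fin k → BallName → BallName → Prop}
    (hR : ∀ i b (x : K), ((s i • x : K) : M) ∈ C.basicBall b ↔
      ∃ j, R i b j ∧ (x : M) ∈ C.basicBall j)
    (u : List (Fin k)) (b : BallName) (x : K) :
    (((u.map s).prod • x : K) : M) ∈ C.basicBall b ↔
      ∃ j, LabelledPath R u b j ∧ (x : M) ∈ C.basicBall j := by
  induction u generalizing b with
  | nil => simp [LabelledPath]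
  | cons i u ih =>
    simp only [List.map_cons, List.prod_cons, mul_smul, hR, ih, LabelledPath]
    constructor
    · rintro ⟨c, hc, j, hj, hx⟩
      exact ⟨j, ⟨c, hc, hj⟩, hx⟩
    · rintro ⟨j, ⟨c, hc, hj⟩, hx⟩
      exact ⟨c, hc, j, hj, hx⟩

/-- For a computable action on a recursively compact set, it is semi-decidable whether finitely
many preimages of basic balls under group elements cover the set. -/
theorem rePred_preimages_cover (hK : C.IsRecursivelyCompact K) {k : ℕ} {s : Fin k → Γ}
    (hs : ∀ i, C.IsComputableMap C (fun x : K => ((s i • x : K) : M))) :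
    REPred fun J : List (List (Fin k) × BallName) =>
      ∀ x : K, ∃ c ∈ J, (((c.1.map s).prod • x : K) : M) ∈ C.basicBall c.2 := by
  classical
  have : CompactSpace K := isCompact_iff_compactSpace.1 hK.1
  choose R hRre hR using hs
  have hR' : ∀ i b (x : K), ((s i • x : K) : M) ∈ C.basicBall b ↔
      ∃ j, R i (b, j) ∧ (x : M) ∈ C.basicBall j :=
    fun i b x => Set.ext_iff.1 (hR i b) x
  have hmem := prod_smul_mem_basicBall_iff (R := fun i b j => R i (b, j)) hR'
  have hpath : REPred fun x : (List (Fin k) × BallName) × BallName =>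
      LabelledPath (fun i b j => R i (b, j)) x.1.1 x.1.2 x.2 :=
    REPred.labelledPath (REPred.fin_cases hRre)
  have h2 : REPred fun x : List (List (Fin k) × BallName) × List BallName =>
      ∀ j ∈ x.2, ∃ c ∈ x.1, LabelledPath (fun i b j => R i (b, j)) c.1 c.2 j :=
    REPred.forall_mem_exists_mem_list
      (p := fun (c : List (Fin k) × BallName) j =>
        LabelledPath (fun i b j => R i (b, j)) c.1 c.2 j) hpath
  have h3 : REPred fun x : List (List (Fin k) × BallName) × List BallName =>
      K ⊆ ⋃ b ∈ x.2, C.basicBall b := hK.2.comp Primrec.snd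
  -- By compactness, the preimages cover `K` exactly when some finite list of balls covers `K` and
  -- each of its balls is reached by a path from a member of `J`.
  refine (REPred.exists_snd (p := fun (J : List (List (Fin k) × BallName)) (I : List BallName) =>
    (K ⊆ ⋃ b ∈ I, C.basicBall b) ∧
      ∀ j ∈ I, ∃ c ∈ J, LabelledPath (fun i b j => R i (b, j)) c.1 c.2 j) (h3.and h2)).of_eq
    fun J => ?_
  constructor
  · rintro ⟨I, hI, hIJ⟩ x
    obtain ⟨j, hj, hx⟩ := mem_iUnion₂.1 (hI x.2)
    obtain ⟨c, hc, hcj⟩ := hIJ j hj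
    exact ⟨c, hc, (hmem c.1 c.2 x).2 ⟨j, hcj, hx⟩⟩
  · intro h
    obtain ⟨F, hF⟩ := hK.1.elim_finite_subcover
      (fun j : {j : BallName //
        ∃ c ∈ J, LabelledPath (fun i b j => R i (b, j)) c.1 c.2 j} => C.basicBall j)
      (fun j => C.isOpen_basicBall j) (by
        intro x hx
        obtain ⟨c, hc, hxc⟩ := h ⟨x, hx⟩
        obtain ⟨j, hj, hxj⟩ := (hmem c.1 c.2 ⟨x, hx⟩).1 hxc
        exact mem_iUnion.2 ⟨⟨j, c, hc, hj⟩, hxj⟩)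
    refine ⟨(F.image Subtype.val).toList, fun x hx => ?_, fun j hj => ?_⟩
    · obtain ⟨j, hjF, hxj⟩ := mem_iUnion₂.1 (hF hx)
      exact mem_iUnion₂.2 ⟨j, Finset.mem_toList.2 (Finset.mem_image_of_mem _ hjF), hxj⟩
    · obtain ⟨j', -, rfl⟩ := Finset.mem_image.1 (Finset.mem_toList.1 hj)
      exact j'.2

end ComputableMetricStructure

/-! ### Symmetric generating sets -/

theorem GeneratesGroup.exists_symmetric {Γ : Type*} [Group Γ] {k : ℕ} {t : Fin k → Γ}
    (ht : GeneratesGroup t) :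
    ∃ (m : ℕ) (s : Fin m → Γ), Function.Injective s ∧ GeneratesGroup s ∧
      ∀ i, (s i)⁻¹ ∈ range s := by
  classical
  let T : Finset Γ := Finset.univ.image t ∪ Finset.univ.image fun i => (t i)⁻¹
  let s : Fin T.card → Γ := fun i => (T.equivFin.symm i : Γ)
  have hrange : ∀ g, g ∈ range s ↔ g ∈ T := by
    intro g
    constructor
    · rintro ⟨i, rfl⟩
      exact (T.equivFin.symm i).2
    · exact fun hg => ⟨T.equivFin ⟨g, hg⟩, by simp [s]⟩
  have htT : ∀ i, t i ∈ range s := fun i => (hrange _).2 (by simp [T])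
  refine ⟨T.card, s, Subtype.val_injective.comp T.equivFin.symm.injective, fun g => ?_,
    fun i => ?_⟩
  · choose r hr using htT
    obtain ⟨w, rfl⟩ := ht g
    exact ⟨w.map r, by rw [List.map_map, show s ∘ r = t from funext hr]⟩
  · have hi : s i ∈ T := (hrange _).1 ⟨i, rfl⟩
    rw [hrange]
    simp only [T, Finset.mem_union, Finset.mem_image, Finset.mem_univ, true_and] at hi ⊢
    rcases hi with ⟨j, hj⟩ | ⟨j, hj⟩
    · exact Or.inr ⟨j, by rw [hj]⟩
    · exact Or.inl ⟨j, by rw [← hj, inv_inv]⟩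

/-- If `t` generates `Γ`, then the inverses of the values of words in the letters `s i` and their
formal inverses can be computed as words in the `t i`. -/
theorem GeneratesGroup.exists_primrec_inv_word {Γ : Type*} [Group Γ] {k m : ℕ} {t : Fin k → Γ}
    (ht : GeneratesGroup t) (s : Fin m → Γ) :
    ∃ τ : List (Fin m × Bool) → List (Fin k), Primrec τ ∧
      ∀ w, ((τ w).map t).prod = (FreeGroup.lift s (FreeGroup.mk w))⁻¹ := by
  choose W hW using ht
  -- The choice `W` is noncomputable, but only its values at the finitely many inverses of signed
  -- letters are used; reversing the word accounts for inverting the product.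
  refine ⟨fun w => w.reverse.flatMap fun c => W (cond c.2 (s c.1) (s c.1)⁻¹)⁻¹,
    Primrec.list_flatMap Primrec.list_reverse ((Primrec.dom_finite
      fun c : Fin m × Bool => W (cond c.2 (s c.1) (s c.1)⁻¹)⁻¹).comp Primrec.snd).to₂,
    fun w => ?_⟩
  rw [FreeGroup.lift_mk]
  induction w with
  | nil => simp
  | cons c w ih => simp [ih, hW]

/-! ### Itinerary subshifts -/

section partitionSubshift

variable {Γ : Type*} [Group Γ] {Y : Type*} [TopologicalSpace Y] [MulAction Γ Y] {n : ℕ}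
  {P : Fin n → Set Y}

/-- The pullback of an itinerary subshift is the set of itineraries of the points under the action
of the free group; in particular consistency of the labels is automatic. -/
theorem mem_pullbackConfigs_partitionSubshift (hP : IsClopenPartition P) {k : ℕ} {s : Fin k → Γ}
    {x : FreeGroup (Fin k) → Fin n} :
    x ∈ pullbackConfigs s (partitionSubshift Γ P) ↔
      ∃ y : Y, ∀ w, (FreeGroup.lift s w)⁻¹ • y ∈ P (x w) := by
  constructor
  · rintro ⟨z, ⟨y, hy⟩, rfl⟩
    exact ⟨y, fun w => hy _⟩
  · rintro ⟨y, hy⟩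
    have hlabel : ∀ g : Γ, ∃ a, g⁻¹ • y ∈ P a := fun g =>
      mem_iUnion.1 (hP.cover ▸ mem_univ (g⁻¹ • y))
    choose z hz using hlabel
    refine ⟨z, ⟨y, hz⟩, funext fun w => ?_⟩
    by_contra hne
    exact disjoint_left.1 (hP.disjoint hne) (hz _) (hy w)

variable [CompactSpace Y] [ContinuousConstSMul Γ Y]

/-- Projection along the compact space `Y` is a closed map, and the subshift is the projection of a
closed relation. -/
theorem isSubshift_partitionSubshift (hP : IsClopenPartition P) :
    IsSubshift (partitionSubshift Γ P) := by
  refine ⟨?_, ?_⟩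
  · have hclosed : IsClosed {z : Y × (Γ → Fin n) | ∀ g : Γ, g⁻¹ • z.1 ∈ P (z.2 g)} := by
      rw [ofPred_forall]
      refine isClosed_iInter fun g => ?_
      have : {z : Y × (Γ → Fin n) | g⁻¹ • z.1 ∈ P (z.2 g)} =
          ⋃ a : Fin n, {z | g⁻¹ • z.1 ∈ P a} ∩ {z | z.2 g = a} := by
        ext z
        simp
      rw [this]
      refine isClosed_iUnion_of_finite fun a => IsClosed.inter ?_ ?_
      · exact (hP.isClopen a).isClosed.preimage (continuous_fst.const_smul g⁻¹)
      · exact isClosed_eq ((continuous_apply g).comp continuous_snd) continuous_const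
    have himage : partitionSubshift Γ P =
        Prod.snd '' {z : Y × (Γ → Fin n) | ∀ g : Γ, g⁻¹ • z.1 ∈ P (z.2 g)} := by
      ext y
      simp [partitionSubshift]
    rw [himage]
    exact isClosedMap_snd_of_compactSpace _ hclosed
  · rintro g y ⟨x, hx⟩
    refine ⟨g • x, fun h => ?_⟩
    have := hx (g⁻¹ * h)
    rwa [mul_inv_rev, inv_inv, mul_smul] at this

theorem isEffectivelyClosed_pullbackConfigs (hP : IsClopenPartition P) {k : ℕ} {s : Fin k → Γ}
    (h : REPred fun p : PatternName k n =>
      ∀ y : Y, ∃ c ∈ p, (FreeGroup.lift s (FreeGroup.mk c.1))⁻¹ • y ∉ P c.2) :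
    IsEffectivelyClosed (pullbackConfigs s (partitionSubshift Γ P)) := by
  refine ⟨_, h, Set.ext fun x => ?_⟩
  rw [mem_compl_iff, mem_pullbackConfigs_partitionSubshift hP]
  constructor
  · intro hx
    push Not at hx
    obtain ⟨F, hF⟩ := isCompact_univ.elim_finite_subcover
      (fun w => {y : Y | (FreeGroup.lift s w)⁻¹ • y ∈ (P (x w))ᶜ})
      (fun w => (hP.isClopen (x w)).compl.isOpen.preimage (continuous_const_smul _))
      (fun y _ => mem_iUnion.2 (hx y))
    refine ⟨F.toList.map fun w => (w.toWord, x w), fun y => ?_, ?_⟩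
    · obtain ⟨w, hw, hy⟩ := mem_iUnion₂.1 (hF (mem_univ y))
      exact ⟨_, List.mem_map.2 ⟨w, Finset.mem_toList.2 hw, rfl⟩, by
        rw [FreeGroup.mk_toWord]
        exact hy⟩
    · intro c hc
      obtain ⟨w, -, rfl⟩ := List.mem_map.1 hc
      simp only [FreeGroup.mk_toWord]
  · rintro ⟨p, hp, hxp⟩ ⟨y, hy⟩
    obtain ⟨c, hc, hyc⟩ := hp y
    exact hyc (hxp c hc ▸ hy (FreeGroup.mk c.1))

end partitionSubshift

/-! ### Factors -/

theorem IsClopenPartition.preimage {X Y : Type*} [TopologicalSpace X] [TopologicalSpace Y] {n : ℕ}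
    {P : Fin n → Set Y} (hP : IsClopenPartition P) {f : X → Y} (hf : Continuous f) :
    IsClopenPartition fun i => f ⁻¹' P i where
  isClopen i := (hP.isClopen i).preimage hf
  disjoint i j hij := (hP.disjoint hij).preimage f
  cover := by rw [← preimage_iUnion, hP.cover, preimage_univ]

theorem IsTopologicalFactorMap.partitionSubshift_preimage {Γ : Type*} [Group Γ] {X Y : Type*}
    [TopologicalSpace X] [MulAction Γ X] [TopologicalSpace Y] [MulAction Γ Y] {f : X → Y}
    (hf : IsTopologicalFactorMap Γ f) {n : ℕ} (P : Fin n → Set Y) :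
    partitionSubshift Γ (fun i => f ⁻¹' P i) = partitionSubshift Γ P := by
  ext z
  simp only [partitionSubshift, mem_ofPred_eq, mem_preimage, hf.map_smul]
  exact (hf.surjective.exists (p := fun y => ∀ g : Γ, g⁻¹ • y ∈ P (z g))).symm

/-- The itinerary subshift of a clopen partition of an effective dynamical system is effective. -/
theorem IsEDS.isEffectiveSubshift_partitionSubshift {Γ : Type uΓ} [Group Γ] {X : Type uX}
    [TopologicalSpace X] [CompactSpace X] [MulAction Γ X] [ContinuousConstSMul Γ X]
    (hX : IsEDS.{uΓ, uX, uM} Γ X) {n : ℕ} {P : Fin n → Set X} (hP : IsClopenPartition P) :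
    IsEffectiveSubshift (partitionSubshift Γ P) := by
  obtain ⟨M, _, C, K, _, hK, ⟨k, t, ht, htc⟩, e, he⟩ := hX
  obtain ⟨m, s, hsinj, hsgen, hssymm⟩ := ht.exists_symmetric
  refine ⟨isSubshift_partitionSubshift hP, m, s, hsinj, hsgen, hssymm,
    isEffectivelyClosed_pullbackConfigs hP ?_⟩
  obtain ⟨τ, hτ, hτinv⟩ := ht.exists_primrec_inv_word s
  -- The conjugacy need not be computable: it enters only through these finitely many lists, which
  -- are constants of the algorithm.
  choose V hV using fun a => C.exists_list_basicBall_of_isClopen hK.1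
    ((hP.isClopen a).compl.preimage e.symm.continuous)
  have hprim : Primrec fun p : PatternName m n =>
      p.flatMap fun c => (V c.2).map fun b => (τ c.1, b) :=
    Primrec.list_flatMap Primrec.id
      (Primrec.list_map ((Primrec.dom_finite V).comp (Primrec.snd.comp Primrec.snd))
        ((hτ.comp (Primrec.fst.comp (Primrec.snd.comp Primrec.fst))).pair Primrec.snd))
  refine ((C.rePred_preimages_cover hK htc).comp hprim).of_eq fun p => ?_
  rw [e.surjective.forall (p := fun x : K => ∃ c ∈ p.flatMap fun c => (V c.2).map fun b =>
    (τ c.1, b), (((c.1.map t).prod • x : K) : M) ∈ C.basicBall c.2)]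
  refine forall_congr' fun x => ?_
  have hx : ∀ c : List (Fin m × Bool) × Fin n,
      (FreeGroup.lift s (FreeGroup.mk c.1))⁻¹ • x ∉ P c.2 ↔
        ∃ b ∈ V c.2, ((((τ c.1).map t).prod • e x : K) : M) ∈ C.basicBall b := by
    intro c
    rw [← hV, hτinv, ← he, mem_preimage, e.symm_apply_apply, mem_compl_iff]
  simp only [hx, List.mem_flatMap, List.mem_map]
  constructor
  · rintro ⟨_, ⟨c, hc, b, hb, rfl⟩, hmem⟩
    exact ⟨c, hc, b, hb, hmem⟩
  · rintro ⟨c, hc, b, hb, hmem⟩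
    exact ⟨_, ⟨c, hc, b, hb, rfl⟩, hmem⟩

theorem mainTheorem6 {Γ : Type uΓ} [Group Γ] [Group.FG Γ]
    {X : Type uX} [TopologicalSpace X] [CompactSpace X] [MetrizableSpace X]
    [MulAction Γ X] [ContinuousConstSMul Γ X]
    {Y : Type uY} [TopologicalSpace Y] [CompactSpace Y] [MetrizableSpace Y]
    [MulAction Γ Y] [ContinuousConstSMul Γ Y]
    (f : X → Y) (hf : IsTopologicalFactorMap Γ f) (hY : IsZeroDimensional Y) :
    (IsRecursivelyPresented Γ → IsEDS.{uΓ, uX, uM} Γ X → IsWEDS Γ Y) ∧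
      (IsWEDS Γ X → IsWEDS Γ Y) := by
  refine ⟨fun _ hX => ⟨hY, fun n P hP => ?_⟩, fun hX => ⟨hY, fun n P hP => ?_⟩⟩
  · rw [← hf.partitionSubshift_preimage P]
    exact hX.isEffectiveSubshift_partitionSubshift (hP.preimage hf.continuous)
  · rw [← hf.partitionSubshift_preimage P]
    exact hX.2 n _ (hP.preimage hf.continuous)
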